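/- **Theorem 1 (Reduction).** *Data.* Let $\mathcal A$ be a set of actions, $\delta,\epsilon\notin\mathcal A$, and let $\gamma$ be a commutative and associative function on pairs from $\mathcal A\cup\{\delta\}$ to $\mathcal A\cup\{\delta\}$ with $\gamma(\delta,a)=\delta$. Call $c\in\mathcal A$ *isolated* if $\gamma(a,b)\neq c$ and $\gamma(a,c)=\delta$ for all $a,b\in\mathcal A$. Let $\mathcal H$ be the set of all finite sequences of pairs $(i,m)$ of positive integers with $i\le m+1$ (*interleaving histories*). Let $S$ be a set of *control states*; for each $n\ge1$ let $\sigma_n:\mathcal H\times S\rightharpoonup\{1,\dots,n\}$ be a partial function (*abstract scheduler*) and $\vartheta_n:\mathcal H\times S\times\{1,\dots,n\}\times(\mathcal A\cup\{\epsilon\})\to S$ a total function (*control state transformer*); let $C\subseteq\mathcal A$, and for each $c\in C$ let $\bar c\in\mathcal A\setminus C$, where all $c$ and $\bar c$ are isolated. Let $D$ be a countable set; for each $d\in D$ let $\mathsf{cr}(d),\overline{\mathsf{cr}}(d)\in\mathcal A\setminus(C\cup\{\bar c: c\in C\})$ be isolated, and let $\phi(d)$ be a closed term of siACP$_\epsilon$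 (signature below). *ACP$_\epsilon$.* Terms are built from a countably infinite set $\mathcal X$ of variables, constants $\delta$, $\epsilon$ and $a$ ($a\in\mathcal A$), binary operators $+,\cdot,\parallel,\lfloor\!\lfloor,\mid$ and unary operators $\partial_H$ ($H\subseteq\mathcal A$). With $a,b$ ranging over $\mathcal A\cup\{\delta\}$, the axioms are: $x+y=y+x$; $(x+y)+z=x+(y+z)$; $x+x=x$; $(x+y)\cdot z=x\cdot z+y\cdot z$; $(x\cdot y)\cdot z=x\cdot(y\cdot z)$; $x+\delta=x$; $\delta\cdot x=\delta$; $x\cdot\epsilon=x$; $\epsilon\cdot x=x$; $\partial_H(\epsilon)=\epsilon$; $\partial_H(a)=a$ if $a\notin H$; $\partial_H(a)=\delta$ if $a\in H$; $\partial_H(x+y)=\partial_H(x)+\partial_H(y)$; $\partial_H(x\cdot y)=\partial_H(x)\cdot\partial_H(y)$; $x\parallel y=x\lfloor\!\lfloor y+y\lfloor\!\lfloor x+x\mid y+\partial_{\mathcal A}(x)\cdot\partial_{\mathcal A}(y)$; $\epsilon\lfloor\!\lfloor x=\delta$; $a\cdot x\lfloor\!\lfloor y=a\cdot(x\parallel y)$;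 $(x+y)\lfloor\!\lfloor z=x\lfloor\!\lfloor z+y\lfloor\!\lfloor z$; $\epsilon\mid x=\delta$; $x\mid\epsilon=\delta$; $a\cdot x\mid b\cdot y=\gamma(a,b)\cdot(x\parallel y)$; $(x+y)\mid z=x\mid z+y\mid z$; $x\mid(y+z)=x\mid y+x\mid z$; $a\mid b=\gamma(a,b)$; $\delta\mid x=\delta$; $x\mid\delta=\delta$. *siACP$_\epsilon$* has in addition the $n$-ary operators $\Vert^n_{h,s}$ and $\lfloor\!\lfloor^{n,i}_{h,s}$ for $1\le i\le n$, $h\in\mathcal H$, $s\in S$. Its axioms are those of ACP$_\epsilon$ and the following, where $\vec x=(x_1,\dots,x_n)$, $\vec x[t]$ is $\vec x$ with its $i$th component replaced by $t$, $\vec x^{\,-}$ is $\vec x$ without its $i$th component, and $a$ ranges over the actions not of the form $\mathsf{cr}(d)$ or $\overline{\mathsf{cr}}(d)$: 1. $\Vert^n_{h,s}(\vec x)=\delta$ if $\sigma_n(h,s)$ is undefined, and $\Vert^n_{h,s}(\vec x)=\lfloor\!\lfloor^{n,\sigma_n(h,s)}_{h,s}(\vec x)$ otherwise; 2. $\lfloor\!\lfloor^{n,i}_{h,s}(\vec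 x[\delta])=\delta$; $\;\lfloor\!\lfloor^{1,i}_{h,s}(\epsilon)=\epsilon$; and, for $n\ge2$, $\lfloor\!\lfloor^{n,i}_{h,s}(\vec x[\epsilon])=\Vert^{n-1}_{h(i,n-1),\,\vartheta_n(h,s,i,\epsilon)}(\vec x^{\,-})$; 3. $\lfloor\!\lfloor^{n,i}_{h,s}(\vec x[a\cdot x'])=\hat a\cdot\Vert^n_{h(i,n),\,\vartheta_n(h,s,i,a)}(\vec x[x'])$, where $\hat a=a$ if $a\notin C$ and $\hat a=\bar a$ if $a\in C$; 4. $\lfloor\!\lfloor^{n,i}_{h,s}(\vec x[\mathsf{cr}(d)\cdot x'])=\overline{\mathsf{cr}}(d)\cdot\Vert^{n+1}_{h(i,n+1),\,\vartheta_n(h,s,i,\mathsf{cr}(d))}(\vec x[x'],\phi(d))$; 5. $\lfloor\!\lfloor^{n,i}_{h,s}(\vec x[x'+x''])=\lfloor\!\lfloor^{n,i}_{h,s}(\vec x[x'])+\lfloor\!\lfloor^{n,i}_{h,s}(\vec x[x''])$; 6. one of the following two conventions for process creation acts, fixed throughout: either (*blocked*) $\lfloor\!\lfloor^{n,i}_{h,s}(\vec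 x[\overline{\mathsf{cr}}(d)\cdot x'])=\delta$ for all $d\in D$, or (*transparent*) $\lfloor\!\lfloor^{n,i}_{h,s}(\vec x[\overline{\mathsf{cr}}(d)\cdot x'])=\overline{\mathsf{cr}}(d)\cdot\Vert^n_{h(i,n),\,\vartheta_n(h,s,i,\overline{\mathsf{cr}}(d))}(\vec x[x'])$ for all $d\in D$. *Guarded recursion.* Let $\mathbf A$ be ACP$_\epsilon$ or siACP$_\epsilon$. An $\mathbf A$ term is *guarded* if each occurrence of a variable in it lies in $t'$ for some subterm $a\cdot t'$ with $a\in\mathcal A$. A *guarded recursive specification* over $\mathbf A$ is a finite or countably infinite set $E=\{X_i=t_i: i\in I\}$ with distinct variables $X_i\in\mathcal X$ and $\mathbf A$ terms $t_i$ in which no other variables occur, such that each $t_i$ can be rewritten, by the axioms of $\mathbf A$ in either direction and the equations $X_j=t_j$ ($j\ne i$) from left to right, in zero or more steps, to a guarded $\mathbf A$ term in which no other variables occur; $\mathrm{vars}(E)$ is the set of variables that occur in $E$. The theory siACP$_\epsilon^{\mathrm{rec}}$ has an additional constant $\langle X|E\rangle$ for each guarded recursive specification $E$ over siACP$_\epsilon$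 and each $X\in\mathrm{vars}(E)$, and the additional axioms $\langle X|E\rangle=\langle t|E\rangle$ for $X=t$ in $E$ (where $\langle t|E\rangle$ is $t$ with each $Y\in\mathrm{vars}(E)$ replaced by $\langle Y|E\rangle$) and $E\Rightarrow X=\langle X|E\rangle$ for $X\in\mathrm{vars}(E)$. Derivability is that of infinitary conditional equational logic. *Claim.* For each guarded recursive specification $E$ over siACP$_\epsilon$ and each $X\in\mathrm{vars}(E)$, there exists a guarded recursive specification $E'$ over ACP$_\epsilon$, with $X\in\mathrm{vars}(E')$, such that $\langle X|E\rangle=\langle X|E'\rangle$ is derivable from the axioms of siACP$_\epsilon^{\mathrm{rec}}$. This holds under each of the two conventions in item 6. -/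

import Mathlib

universe u v w z

namespace StrategicInterleaving

/-! ## Terms -/

/-- One entry `(i, m)` of an interleaving history: process number `proc` got a turn, and after it
there were `count` processes left to be interleaved. As a turn changes the number of processes by
at most one and is given to one of the processes present, `proc ≤ count + 1`. -/
structure Turn where
  proc : ℕ
  count : ℕ
  one_le_proc : 1 ≤ proc
  one_le_count : 1 ≤ count
  proc_le : proc ≤ count + 1

/-- The pair `(i + 1, m + 1)`: the process in (zero-based) position `i` got a turn, and then there
were `m + 1` processes. -/
def turn (i m : ℕ) (h : i ≤ m + 1) : Turn :=
  ⟨i + 1, m + 1, Nat.le_add_left 1 i, Nat.le_add_left 1 m, Nat.succ_le_succ h⟩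

/-- Interleaving histories; the most recent turn is the last entry of the list. -/
abbrev History := List Turn

/-- Terms over actions `A`, control states `S`, extra constants `K`, and the countably infinite set
`ℕ` of variables. The interleaving operators of arity `n + 1` are indexed by `n`, and positions
are zero-based. With `K = Empty` these are the siACPε terms. -/
inductive Term (A : Type u) (S : Type v) (K : Type w) : Type (max u v w)
  | dead : Term A S K
  | empty : Term A S K
  | act (a : A) : Term A S K
  | const (k : K) : Term A S K
  | var (x : ℕ) : Term A S K
  | alt (p q : Term A S K) : Term A S K
  | seq (p q : Term A S K) : Term A S K
  | par (p q : Term A S K) : Term A S K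
  | leftm (p q : Term A S K) : Term A S K
  | commm (p q : Term A S K) : Term A S K
  | encap (H : Set A) (p : Term A S K) : Term A S K
  | si (n : ℕ) (h : History) (s : S) (x : Fin (n + 1) → Term A S K) : Term A S K
  | posm (n : ℕ) (i : Fin (n + 1)) (h : History) (s : S) (x : Fin (n + 1) → Term A S K) :
      Term A S K

namespace Term

variable {A : Type u} {S : Type v} {K : Type w}

/-- The constant for an element of `Act ∪ {δ}`, where `none` is `δ`. -/
def ofAct : Option A → Term A S K
  | none => dead
  | some a => act a

/-- The set of variables that occur in a term. -/
def vars : Term A S K → Set ℕ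
  | dead => ∅
  | empty => ∅
  | act _ => ∅
  | const _ => ∅
  | var x => {x}
  | alt p q => p.vars ∪ q.vars
  | seq p q => p.vars ∪ q.vars
  | par p q => p.vars ∪ q.vars
  | leftm p q => p.vars ∪ q.vars
  | commm p q => p.vars ∪ q.vars
  | encap _ p => p.vars
  | si _ _ _ x => ⋃ j, (x j).vars
  | posm _ _ _ _ x => ⋃ j, (x j).vars

/-- All occurrences of variables in the term are guarded, i.e. lie inside `t'` for some subterm
`a · t'` where `a` is an action constant. -/
def Guarded : Term A S K → Prop
  | dead => True
  | empty => True
  | act _ => True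
  | const _ => True
  | var _ => False
  | alt p q => p.Guarded ∧ q.Guarded
  | seq p q => p.Guarded ∧ ((∃ a, p = act a) ∨ q.Guarded)
  | par p q => p.Guarded ∧ q.Guarded
  | leftm p q => p.Guarded ∧ q.Guarded
  | commm p q => p.Guarded ∧ q.Guarded
  | encap _ p => p.Guarded
  | si _ _ _ x => ∀ j, (x j).Guarded
  | posm _ _ _ _ x => ∀ j, (x j).Guarded

/-- The term is an ACPε term: no (positional) strategic interleaving operator and no extra
constant occurs in it. -/
def IsACP : Term A S K → Prop
  | dead => True
  | empty => True
  | act _ => True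
  | const _ => False
  | var _ => True
  | alt p q => p.IsACP ∧ q.IsACP
  | seq p q => p.IsACP ∧ q.IsACP
  | par p q => p.IsACP ∧ q.IsACP
  | leftm p q => p.IsACP ∧ q.IsACP
  | commm p q => p.IsACP ∧ q.IsACP
  | encap _ p => p.IsACP
  | si _ _ _ _ => False
  | posm _ _ _ _ _ => False

/-- Simultaneous substitution of terms for all variables of a siACPε term. -/
def inst (σ : ℕ → Term A S K) : Term A S Empty → Term A S K
  | dead => dead
  | empty => empty
  | act a => act a
  | var x => σ x
  | alt p q => alt (inst σ p) (inst σ q)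
  | seq p q => seq (inst σ p) (inst σ q)
  | par p q => par (inst σ p) (inst σ q)
  | leftm p q => leftm (inst σ p) (inst σ q)
  | commm p q => commm (inst σ p) (inst σ q)
  | encap H p => encap H (inst σ p)
  | si n h s x => si n h s (fun j => inst σ (x j))
  | posm n i h s x => posm n i h s (fun j => inst σ (x j))

end Term

/-! ## The data that the algebras depend on -/

/-- A communication function on `Act ∪ {δ}`; `none` is `δ`. -/
structure Communication (A : Type u) where
  γ : Option A → Option A → Option A
  comm : ∀ a b, γ a b = γ b a
  assoc : ∀ a b c, γ (γ a b) c = γ a (γ b c)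
  dead_left : ∀ a, γ none a = none

/-- An action that takes no part in communication, neither as an argument nor as a result. -/
def Communication.Isolated {A : Type u} (G : Communication A) (c : A) : Prop :=
  (∀ a b : A, G.γ (some a) (some b) ≠ some c) ∧ ∀ a : A, G.γ (some a) (some c) = none

/-- The interleaving strategy (control states `S`) and the process creation data (data `D`) of
siACPε. -/
structure Strategy (A : Type u) (S : Type v) (D : Type z) (G : Communication A) where
  /-- Abstract scheduler for `n + 1` processes; `none` means undefined. -/
  sched : (n : ℕ) → History → S → Option (Fin (n + 1))
  /-- Control state transformer for `n + 1` processes; in the last argument, `none` is `ε`. -/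
  updat : (n : ℕ) → History → S → Fin (n + 1) → Option A → S
  /-- The control actions. -/
  C : Set A
  /-- The trace left by a control action; only its values on `C` matter. -/
  bar : A → A
  bar_not_mem : ∀ c ∈ C, bar c ∉ C
  isolated_control : ∀ c ∈ C, G.Isolated c
  isolated_bar : ∀ c ∈ C, G.Isolated (bar c)
  /-- The process that is created on the basis of a datum: a closed siACPε term. -/
  created : D → {t : Term A S Empty // t.vars = ∅}
  /-- Process creation requests. -/
  req : D → A
  /-- Process creation acts. -/
  crAct : D → A
  req_not_mem : ∀ d, req d ∉ C ∪ bar '' C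
  crAct_not_mem : ∀ d, crAct d ∉ C ∪ bar '' C
  isolated_req : ∀ d, G.Isolated (req d)
  isolated_crAct : ∀ d, G.Isolated (crAct d)

/-- The two conventions for an interleaved process whose turn it is and which performs a process
creation act: it is blocked, or the act is treated like any other action. -/
inductive CrActMode
  | blocked
  | transparent

/-! ## Axioms -/

section Axioms

variable {A : Type u} {S : Type v} {D : Type z} {K : Type w}

open Term

/-- All substitution instances of the axioms of ACPε. Here `a` and `b` range over the constants
other than `ε`, i.e. over `Act ∪ {δ}`. -/
inductive AxACP (G : Communication A) : Term A S K → Term A S K → Prop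
  | A1 (x y) : AxACP G (alt x y) (alt y x)
  | A2 (x y z) : AxACP G (alt (alt x y) z) (alt x (alt y z))
  | A3 (x) : AxACP G (alt x x) x
  | A4 (x y z) : AxACP G (seq (alt x y) z) (alt (seq x z) (seq y z))
  | A5 (x y z) : AxACP G (seq (seq x y) z) (seq x (seq y z))
  | A6 (x) : AxACP G (alt x dead) x
  | A7 (x) : AxACP G (seq dead x) dead
  | A8 (x) : AxACP G (seq x empty) x
  | A9 (x) : AxACP G (seq empty x) x
  | D0 (H) : AxACP G (encap H empty) empty
  | D1 (H) (a : Option A) (ha : ∀ b, a = some b → b ∉ H) :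
      AxACP G (encap H (ofAct a)) (ofAct a)
  | D2 (H) (a : A) (ha : a ∈ H) : AxACP G (encap H (act a)) dead
  | D3 (H) (x y) : AxACP G (encap H (alt x y)) (alt (encap H x) (encap H y))
  | D4 (H) (x y) : AxACP G (encap H (seq x y)) (seq (encap H x) (encap H y))
  | CM1T (x y) : AxACP G (par x y)
      (alt (alt (alt (leftm x y) (leftm y x)) (commm x y))
        (seq (encap Set.univ x) (encap Set.univ y)))
  | CM2T (x) : AxACP G (leftm empty x) dead
  | CM3 (a : Option A) (x y) :
      AxACP G (leftm (seq (ofAct a) x) y) (seq (ofAct a) (par x y))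
  | CM4 (x y z) : AxACP G (leftm (alt x y) z) (alt (leftm x z) (leftm y z))
  | CM5T (x) : AxACP G (commm empty x) dead
  | CM6T (x) : AxACP G (commm x empty) dead
  | CM7 (a b : Option A) (x y) :
      AxACP G (commm (seq (ofAct a) x) (seq (ofAct b) y)) (seq (ofAct (G.γ a b)) (par x y))
  | CM8 (x y z) : AxACP G (commm (alt x y) z) (alt (commm x z) (commm y z))
  | CM9 (x y z) : AxACP G (commm x (alt y z)) (alt (commm x y) (commm x z))
  | CM10 (a b : Option A) : AxACP G (commm (ofAct a) (ofAct b)) (ofAct (G.γ a b))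
  | CM11 (x) : AxACP G (commm dead x) dead
  | CM12 (x) : AxACP G (commm x dead) dead

/-- All substitution instances of the axioms for strategic interleaving. An argument list in which
the `i`th argument has been replaced by `t` is `Function.update x i t`; an argument list without
its `i`th argument is `i.removeNth x`. -/
inductive AxSI {G : Communication A} (T : Strategy A S D G) (m : CrActMode) :
    Term A S K → Term A S K → Prop
  | SI0 (n h s x) (hs : T.sched n h s = none) : AxSI T m (si n h s x) dead
  | SI1 (n i h s x) (hs : T.sched n h s = some i) : AxSI T m (si n h s x) (posm n i h s x)
  | SI2 (n i h s x) (hx : x i = dead) : AxSI T m (posm n i h s x) dead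
  | SI3T (i h s x) (hx : x i = empty) : AxSI T m (posm 0 i h s x) empty
  | SI4T (n) (i : Fin (n + 2)) (h s x) (hx : x i = empty) :
      AxSI T m (posm (n + 1) i h s x)
        (si n (h ++ [turn i n (by omega)]) (T.updat (n + 1) h s i none) (i.removeNth x))
  | SI5Ta (n) (i : Fin (n + 1)) (h s x a t) (hx : x i = seq (act a) t)
      (ha : ∀ d, a ≠ T.req d ∧ a ≠ T.crAct d) (hC : a ∉ T.C) :
      AxSI T m (posm n i h s x)
        (seq (act a) (si n (h ++ [turn i n (by omega)]) (T.updat n h s i (some a))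
          (Function.update x i t)))
  | SI5Tb (n) (i : Fin (n + 1)) (h s x a t) (hx : x i = seq (act a) t)
      (ha : ∀ d, a ≠ T.req d ∧ a ≠ T.crAct d) (hC : a ∈ T.C) :
      AxSI T m (posm n i h s x)
        (seq (act (T.bar a)) (si n (h ++ [turn i n (by omega)]) (T.updat n h s i (some a))
          (Function.update x i t)))
  | SI7 (n) (i : Fin (n + 1)) (h s x d t) (hx : x i = seq (act (T.req d)) t) :
      AxSI T m (posm n i h s x)
        (seq (act (T.crAct d))
          (si (n + 1) (h ++ [turn i (n + 1) (by omega)]) (T.updat n h s i (some (T.req d)))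
            (Fin.snoc (α := fun _ => Term A S K) (Function.update x i t)
              (inst var (T.created d).1))))
  | SI8 (n i h s x t t') (hx : x i = alt t t') :
      AxSI T m (posm n i h s x)
        (alt (posm n i h s (Function.update x i t)) (posm n i h s (Function.update x i t')))
  | crActBlocked (n) (i : Fin (n + 1)) (h s x d t) (hm : m = CrActMode.blocked)
      (hx : x i = seq (act (T.crAct d)) t) :
      AxSI T m (posm n i h s x) dead
  | crActTransparent (n) (i : Fin (n + 1)) (h s x d t) (hm : m = CrActMode.transparent)
      (hx : x i = seq (act (T.crAct d)) t) :
      AxSI T m (posm n i h s x)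
        (seq (act (T.crAct d))
          (si n (h ++ [turn i n (by omega)]) (T.updat n h s i (some (T.crAct d)))
            (Function.update x i t)))

/-- All substitution instances of the axioms of siACPε. -/
def AxSIACP {G : Communication A} (T : Strategy A S D G) (m : CrActMode)
    (l r : Term A S K) : Prop :=
  AxACP G l r ∨ AxSI T m l r

end Axioms

/-! ## Guarded recursive specifications -/

section Recursion

variable {A : Type u} {S : Type v} {D : Type z}

/-- `Rewrites L Ax Eqn t t'`: inside the language `L`, the term `t` can be rewritten to `t'` using
the axioms `Ax` in either direction and the equations `Eqn` from left to right, in any context. -/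
inductive Rewrites (L : Term A S Empty → Prop) (Ax Eqn : Term A S Empty → Term A S Empty → Prop) :
    Term A S Empty → Term A S Empty → Prop
  | refl (t) : Rewrites L Ax Eqn t t
  | trans {t t' t''} : Rewrites L Ax Eqn t t' → L t' → Rewrites L Ax Eqn t' t'' →
      Rewrites L Ax Eqn t t''
  | ax {t t'} : Ax t t' → Rewrites L Ax Eqn t t'
  | ax_symm {t t'} : Ax t t' → Rewrites L Ax Eqn t' t
  | eqn {t t'} : Eqn t t' → Rewrites L Ax Eqn t t'
  | alt {p p' q q'} : Rewrites L Ax Eqn p p' → Rewrites L Ax Eqn q q' →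
      Rewrites L Ax Eqn (.alt p q) (.alt p' q')
  | seq {p p' q q'} : Rewrites L Ax Eqn p p' → Rewrites L Ax Eqn q q' →
      Rewrites L Ax Eqn (.seq p q) (.seq p' q')
  | par {p p' q q'} : Rewrites L Ax Eqn p p' → Rewrites L Ax Eqn q q' →
      Rewrites L Ax Eqn (.par p q) (.par p' q')
  | leftm {p p' q q'} : Rewrites L Ax Eqn p p' → Rewrites L Ax Eqn q q' →
      Rewrites L Ax Eqn (.leftm p q) (.leftm p' q')
  | commm {p p' q q'} : Rewrites L Ax Eqn p p' → Rewrites L Ax Eqn q q' →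
      Rewrites L Ax Eqn (.commm p q) (.commm p' q')
  | encap {H p p'} : Rewrites L Ax Eqn p p' → Rewrites L Ax Eqn (.encap H p) (.encap H p')
  | si {n h s x x'} : (∀ j, Rewrites L Ax Eqn (x j) (x' j)) →
      Rewrites L Ax Eqn (.si n h s x) (.si n h s x')
  | posm {n i h s x x'} : (∀ j, Rewrites L Ax Eqn (x j) (x' j)) →
      Rewrites L Ax Eqn (.posm n i h s x) (.posm n i h s x')

/-- A finite or countably infinite set of equations `X = t` with different left-hand sides:
`E X = some t` means that `X = t` is one of the equations. -/
abbrev Spec (A : Type u) (S : Type v) := ℕ → Option (Term A S Empty)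

/-- The variables that are the left-hand side of an equation. -/
def Spec.lhs (E : Spec A S) : Set ℕ := {X | ∃ t, E X = some t}

/-- The variables that occur in a specification. -/
def Spec.vars (E : Spec A S) : Set ℕ := E.lhs ∪ {X | ∃ Y t, E Y = some t ∧ X ∈ t.vars}

/-- The equations of `E` other than the one for `X`. -/
def Spec.Others (E : Spec A S) (X : ℕ) (l r : Term A S Empty) : Prop :=
  ∃ Y, Y ≠ X ∧ l = .var Y ∧ E Y = some r

/-- `E` is a guarded recursive specification over the algebra with terms `L` and axioms `Ax`:
no variable without an equation occurs in it, and each right-hand side can be rewritten, by axioms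
in either direction and the other equations from left to right, to a guarded term (possibly in
zero steps). -/
def Spec.IsGuarded (L : Term A S Empty → Prop) (Ax : Term A S Empty → Term A S Empty → Prop)
    (E : Spec A S) : Prop :=
  ∀ X t, E X = some t → L t ∧ t.vars ⊆ E.lhs ∧
    ∃ t', L t' ∧ t'.vars ⊆ E.lhs ∧ t'.Guarded ∧ Rewrites L Ax (E.Others X) t t'

/-- Guarded recursive specifications over ACPε. -/
def Spec.IsGuardedACP (G : Communication A) (E : Spec A S) : Prop :=
  E.IsGuarded Term.IsACP (AxACP G)

/-- Guarded recursive specifications over siACPε. -/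
def Spec.IsGuardedSIACP {G : Communication A} (T : Strategy A S D G) (m : CrActMode)
    (E : Spec A S) : Prop :=
  E.IsGuarded (fun _ => True) (AxSIACP T m)

theorem Rewrites.mono {L L' : Term A S Empty → Prop}
    {Ax Ax' Eqn : Term A S Empty → Term A S Empty → Prop}
    (hL : ∀ t, L t → L' t) (hAx : ∀ l r, Ax l r → Ax' l r) {t t' : Term A S Empty}
    (h : Rewrites L Ax Eqn t t') : Rewrites L' Ax' Eqn t t' := by
  induction h with
  | refl t => exact .refl t
  | trans _ hm _ ih₁ ih₂ => exact .trans ih₁ (hL _ hm) ih₂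
  | ax h => exact .ax (hAx _ _ h)
  | ax_symm h => exact .ax_symm (hAx _ _ h)
  | eqn h => exact .eqn h
  | alt _ _ ih₁ ih₂ => exact .alt ih₁ ih₂
  | seq _ _ ih₁ ih₂ => exact .seq ih₁ ih₂
  | par _ _ ih₁ ih₂ => exact .par ih₁ ih₂
  | leftm _ _ ih₁ ih₂ => exact .leftm ih₁ ih₂
  | commm _ _ ih₁ ih₂ => exact .commm ih₁ ih₂
  | encap _ ih => exact .encap ih
  | si _ ih => exact .si ih
  | posm _ ih => exact .posm ih

/-- A guarded recursive specification over ACPε is one over siACPε. -/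
theorem Spec.IsGuardedACP.toSIACP {G : Communication A} (T : Strategy A S D G) (m : CrActMode)
    {E : Spec A S} (h : E.IsGuardedACP G) : E.IsGuardedSIACP T m := by
  intro X t hX
  obtain ⟨-, hv, t', -, hv', hg, hr⟩ := h X t hX
  exact ⟨trivial, hv, t', trivial, hv', hg, hr.mono (fun _ _ => trivial) (fun _ _ => Or.inl)⟩

/-- The constants `⟨X|E⟩`, for `E` a guarded recursive specification over siACPε and
`X ∈ vars(E)`. -/
structure RecConst {G : Communication A} (T : Strategy A S D G) (m : CrActMode) where
  E : Spec A S
  guarded : E.IsGuardedSIACP T m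
  X : ℕ
  mem : X ∈ E.vars

/-- Terms of siACPε with guarded recursion. -/
abbrev RecTerm {G : Communication A} (T : Strategy A S D G) (m : CrActMode) :=
  Term A S (RecConst T m)

/-- The term `⟨X|E⟩`. -/
def recTerm {G : Communication A} (T : Strategy A S D G) (m : CrActMode) (E : Spec A S)
    (hE : E.IsGuardedSIACP T m) (X : ℕ) (hX : X ∈ E.vars) : RecTerm T m :=
  .const ⟨E, hE, X, hX⟩

open Classical in
/-- The substitution of `⟨X|E⟩` for each `X ∈ vars(E)`. -/
noncomputable def recSubst {G : Communication A} (T : Strategy A S D G) (m : CrActMode)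
    (E : Spec A S) (hE : E.IsGuardedSIACP T m) (X : ℕ) : RecTerm T m :=
  if hX : X ∈ E.vars then recTerm T m E hE X hX else .var X

/-- Derivability of equations from the axioms of siACPε with guarded recursion, in infinitary
conditional equational logic. The axioms are given by all their substitution instances. -/
inductive Derivable {G : Communication A} (T : Strategy A S D G) (m : CrActMode) :
    RecTerm T m → RecTerm T m → Prop
  | refl (t) : Derivable T m t t
  | symm {t t'} : Derivable T m t t' → Derivable T m t' t
  | trans {t t' t''} : Derivable T m t t' → Derivable T m t' t'' → Derivable T m t t''
  | alt {p p' q q'} : Derivable T m p p' → Derivable T m q q' →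
      Derivable T m (.alt p q) (.alt p' q')
  | seq {p p' q q'} : Derivable T m p p' → Derivable T m q q' →
      Derivable T m (.seq p q) (.seq p' q')
  | par {p p' q q'} : Derivable T m p p' → Derivable T m q q' →
      Derivable T m (.par p q) (.par p' q')
  | leftm {p p' q q'} : Derivable T m p p' → Derivable T m q q' →
      Derivable T m (.leftm p q) (.leftm p' q')
  | commm {p p' q q'} : Derivable T m p p' → Derivable T m q q' →
      Derivable T m (.commm p q) (.commm p' q')
  | encap {H p p'} : Derivable T m p p' → Derivable T m (.encap H p) (.encap H p')
  | si {n h s x x'} : (∀ j, Derivable T m (x j) (x' j)) →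
      Derivable T m (.si n h s x) (.si n h s x')
  | posm {n i h s x x'} : (∀ j, Derivable T m (x j) (x' j)) →
      Derivable T m (.posm n i h s x) (.posm n i h s x')
  | ax {t t'} : AxSIACP T m t t' → Derivable T m t t'
  | rdp (E hE X hX t) : E X = some t →
      Derivable T m (recTerm T m E hE X hX) (t.inst (recSubst T m E hE))
  | rsp (E hE X hX) (σ : ℕ → RecTerm T m) :
      (∀ Y t, E Y = some t → Derivable T m (σ Y) (t.inst σ)) →
      Derivable T m (σ X) (recTerm T m E hE X hX)

end Recursion

end StrategicInterleaving

/-! Call a finite sum of terms `δ`, `ε` and `a · t` with `t` closed a head normal form. Every closed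
term, possibly containing constants `⟨X|E⟩`, is derivably equal to one (`hasHNF_of_closed`). For the
ACPε operators this is the usual elimination of the operator by its axioms. For interleaving, the
only axiom that calls for a head normal form of another interleaving term without putting an action
in front of it is the one for a terminated process, and it lowers the number of processes
(`hasHNF_posm_of_isHNF`, `hasHNF_si`). For `⟨X|E⟩`, unfold the equation of `X` and follow its
rewriting to a guarded term: variables of a guarded term lie behind action prefixes, so what is
substituted for them need only be closed (`hasHNF_inst_of_guarded`, `hasHNF_recTerm`).

A head normal form mentions no interleaving operator outside the terms behind its prefixes.
Replacing these terms by variables leaves a guarded ACPε term, and the replaced terms are closed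
again, so the process repeats. Starting from `⟨X|E⟩` this gives a countable tree of closed terms,
indexed by lists of numbers, in which each node is derivably a guarded ACPε term in its children.
Reading the nodes as variables gives `E'`. The closed terms solve `E'` by construction, and RSP
identifies the one at the root with `⟨X|E'⟩` (`exists_spec_of_closed`). -/

namespace StrategicInterleaving

/-! ### Substitution in siACPε terms. -/

namespace Term

variable {A : Type u} {S : Type v} {K : Type w}

theorem inst_ofAct (σ : ℕ → Term A S K) (a : Option A) : (ofAct a).inst σ = ofAct a := by
  cases a <;> rfl

theorem inst_update {n : ℕ} (σ : ℕ → Term A S K) (x : Fin n → Term A S Empty) (i : Fin n)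
    (t : Term A S Empty) :
    (fun j => (Function.update x i t j).inst σ) =
      Function.update (fun j => (x j).inst σ) i (t.inst σ) := by
  funext j
  by_cases hj : j = i
  · subst hj; simp
  · simp [hj]

theorem inst_snoc {n : ℕ} (σ : ℕ → Term A S K) (x : Fin n → Term A S Empty)
    (t : Term A S Empty) :
    (fun j => (Fin.snoc (α := fun _ => Term A S Empty) x t j).inst σ) =
      Fin.snoc (α := fun _ => Term A S K) (fun j => (x j).inst σ) (t.inst σ) := by
  funext j
  refine Fin.lastCases ?_ (fun j => ?_) j <;> simp

/-- Substituting into a renamed term. -/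
theorem inst_inst_var (σ : ℕ → Term A S K) (f : ℕ → ℕ) (t : Term A S Empty) :
    (t.inst fun k => var (f k)).inst σ = t.inst fun k => σ (f k) := by
  induction t with
  | const k => exact k.elim
  | _ => simp_all [inst]

theorem inst_congr {σ τ : ℕ → Term A S K} {t : Term A S Empty}
    (h : ∀ Y ∈ t.vars, σ Y = τ Y) : t.inst σ = t.inst τ := by
  induction t with
  | const k => exact k.elim
  | si n _ _ x ih | posm n _ _ _ x ih =>
    simp only [inst]
    congr 1
    exact funext fun j => ih j fun Y hY => h Y (Set.mem_iUnion_of_mem j hY)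
  | _ => simp_all [inst, vars]

/-- This serves the process creation axiom, where the created process appears as `inst var` of a
closed term and must survive a further substitution. -/
theorem inst_var_of_closed (σ : ℕ → Term A S K) {t : Term A S Empty} (h : t.vars = ∅) :
    (t.inst (var : ℕ → Term A S Empty)).inst σ = t.inst (var : ℕ → Term A S K) := by
  rw [inst_inst_var σ (fun k => k)]
  exact inst_congr (by simp [h])

theorem vars_inst_eq_empty {σ : ℕ → Term A S K} {t : Term A S Empty}
    (h : ∀ Y ∈ t.vars, (σ Y).vars = ∅) : (t.inst σ).vars = ∅ := by
  induction t with
  | const k => exact k.elim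
  | si n _ _ x ih | posm n _ _ _ x ih =>
    exact Set.iUnion_eq_empty.2 fun j => ih j fun Y hY => h Y (Set.mem_iUnion_of_mem j hY)
  | _ => simp_all [inst, vars]

theorem isACP_inst_var {t : Term A S Empty} (f : ℕ → ℕ) (h : t.IsACP) :
    (t.inst fun k => var (f k) : Term A S K).IsACP := by
  induction t with
  | const k => exact k.elim
  | _ => simp_all [inst, IsACP]

theorem guarded_inst_var {t : Term A S Empty} (f : ℕ → ℕ) (h : t.Guarded) :
    (t.inst fun k => var (f k) : Term A S K).Guarded := by
  induction t with
  | const k => exact k.elim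
  | seq p q ihp ihq =>
    refine ⟨ihp h.1, ?_⟩
    rcases h.2 with ⟨a, rfl⟩ | hq
    · exact Or.inl ⟨a, rfl⟩
    · exact Or.inr (ihq hq)
  | _ => simp_all [inst, Guarded]

end Term

/-! ### Closure of the axioms under substitution. -/

section AxiomInstances

variable {A : Type u} {S : Type v} {D : Type z} {K : Type w} {G : Communication A}

open Term

theorem AxACP.inst (σ : ℕ → Term A S K) {l r : Term A S Empty} (h : AxACP G l r) :
    AxACP G (l.inst σ) (r.inst σ) := by
  cases h <;> simp only [Term.inst, inst_ofAct] <;> constructor <;> assumption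

theorem AxSI.inst {T : Strategy A S D G} {m : CrActMode} (σ : ℕ → Term A S K)
    {l r : Term A S Empty} (h : AxSI T m l r) : AxSI T m (l.inst σ) (r.inst σ) := by
  cases h with
  | SI0 n h s x hs => exact .SI0 _ _ _ _ hs
  | SI1 n i h s x hs => exact .SI1 _ _ _ _ _ hs
  | SI2 n i h s x hx => exact .SI2 _ _ _ _ _ (by simp [hx, Term.inst])
  | SI3T i h s x hx => exact .SI3T _ _ _ _ (by simp [hx, Term.inst])
  | SI4T n i h s x hx => exact .SI4T _ i _ _ (fun j => (x j).inst σ) (by simp [hx, Term.inst])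
  | SI5Ta n i h s x a t hx ha hC =>
    simpa only [Term.inst, inst_update] using
      AxSI.SI5Ta n i h s (fun j => (x j).inst σ) a (t.inst σ) (by simp [hx, Term.inst]) ha hC
  | SI5Tb n i h s x a t hx ha hC =>
    simpa only [Term.inst, inst_update] using
      AxSI.SI5Tb n i h s (fun j => (x j).inst σ) a (t.inst σ) (by simp [hx, Term.inst]) ha hC
  | SI7 n i h s x d t hx =>
    simpa only [Term.inst, inst_snoc, inst_update, inst_var_of_closed σ (T.created d).2] using
      AxSI.SI7 n i h s (fun j => (x j).inst σ) d (t.inst σ) (by simp [hx, Term.inst])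
  | SI8 n i h s x t t' hx =>
    simpa only [Term.inst, inst_update] using
      AxSI.SI8 n i h s (fun j => (x j).inst σ) (t.inst σ) (t'.inst σ) (by simp [hx, Term.inst])
  | crActBlocked n i h s x d t hm hx =>
    exact .crActBlocked _ _ _ _ _ d (t.inst σ) hm (by simp [hx, Term.inst])
  | crActTransparent n i h s x d t hm hx =>
    simpa only [Term.inst, inst_update] using
      AxSI.crActTransparent n i h s (fun j => (x j).inst σ) d (t.inst σ) hm
        (by simp [hx, Term.inst])

end AxiomInstances

/-! ### Head normal forms and the ACPε operators. -/

section HeadNormalForms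

variable {A : Type u} {S : Type v} {D : Type z} {G : Communication A} {T : Strategy A S D G}
  {m : CrActMode}

open Term

/-- Carries the rewriting that witnesses guardedness over to the derivation system, for any
substitution under which the equations used are derivable. -/
theorem Rewrites.derivable_inst {L : Term A S Empty → Prop}
    {Eqn : Term A S Empty → Term A S Empty → Prop} {σ : ℕ → RecTerm T m}
    (hEqn : ∀ l r, Eqn l r → Derivable T m (l.inst σ) (r.inst σ)) {t t' : Term A S Empty}
    (h : Rewrites L (AxSIACP T m) Eqn t t') : Derivable T m (t.inst σ) (t'.inst σ) := by
  have hax : ∀ {l r : Term A S Empty}, AxSIACP T m l r →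
      Derivable T m (l.inst σ) (r.inst σ) := fun h =>
    .ax (h.imp (fun h => h.inst σ) (fun h => h.inst σ))
  induction h with
  | refl t => exact .refl _
  | trans _ _ _ ih₁ ih₂ => exact .trans ih₁ ih₂
  | ax h => exact hax h
  | ax_symm h => exact .symm (hax h)
  | eqn h => exact hEqn _ _ h
  | alt _ _ ih₁ ih₂ => exact .alt ih₁ ih₂
  | seq _ _ ih₁ ih₂ => exact .seq ih₁ ih₂
  | par _ _ ih₁ ih₂ => exact .par ih₁ ih₂
  | leftm _ _ ih₁ ih₂ => exact .leftm ih₁ ih₂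
  | commm _ _ ih₁ ih₂ => exact .commm ih₁ ih₂
  | encap _ ih => exact .encap ih
  | si _ ih => exact .si ih
  | posm _ ih => exact .posm ih

theorem Derivable.of_acp {t t' : RecTerm T m} (h : AxACP G t t') : Derivable T m t t' :=
  .ax (Or.inl h)

theorem Derivable.of_si {t t' : RecTerm T m} (h : AxSI T m t t') : Derivable T m t t' :=
  .ax (Or.inr h)

/-- Head normal forms: sums of terms `δ`, `ε` and `a · t` with `t` closed. -/
inductive IsHNF (T : Strategy A S D G) (m : CrActMode) : RecTerm T m → Prop
  | dead : IsHNF T m dead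
  | empty : IsHNF T m empty
  | pre (a : A) (t) (ht : t.vars = ∅) : IsHNF T m (seq (act a) t)
  | alt {p q} : IsHNF T m p → IsHNF T m q → IsHNF T m (alt p q)

/-- Terms that are derivably equal to a head normal form. -/
def HasHNF (T : Strategy A S D G) (m : CrActMode) (t : RecTerm T m) : Prop :=
  ∃ u, IsHNF T m u ∧ Derivable T m t u

theorem IsHNF.closed {t : RecTerm T m} (h : IsHNF T m t) : t.vars = ∅ := by
  induction h <;> simp_all [vars]

theorem IsHNF.hasHNF {t : RecTerm T m} (h : IsHNF T m t) : HasHNF T m t := ⟨t, h, .refl t⟩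

theorem HasHNF.of_derivable {t t' : RecTerm T m} (h : HasHNF T m t') (ht : Derivable T m t t') :
    HasHNF T m t :=
  let ⟨u, hu, hd⟩ := h
  ⟨u, hu, ht.trans hd⟩

theorem HasHNF.alt {p q : RecTerm T m} (hp : HasHNF T m p) (hq : HasHNF T m q) :
    HasHNF T m (alt p q) :=
  let ⟨_, hu, hpu⟩ := hp
  let ⟨_, hv, hqv⟩ := hq
  ⟨_, .alt hu hv, .alt hpu hqv⟩

theorem HasHNF.dead : HasHNF T m dead := IsHNF.dead.hasHNF

theorem HasHNF.empty : HasHNF T m empty := IsHNF.empty.hasHNF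

/-- Covers prefixes whose head may turn out to be `δ`, as after encapsulation or a communication. -/
theorem hasHNF_seq_ofAct (a : Option A) {t : RecTerm T m} (ht : t.vars = ∅) :
    HasHNF T m (seq (ofAct a) t) := by
  cases a with
  | none => exact HasHNF.dead.of_derivable (.of_acp (.A7 _))
  | some a => exact (IsHNF.pre a t ht).hasHNF

theorem hasHNF_act (a : A) : HasHNF T m (act a) :=
  (IsHNF.pre a Term.empty rfl).hasHNF.of_derivable (.symm (.of_acp (.A8 _)))

/-- A head normal form of `q` is needed only for the summands `ε` of `p`; behind a prefix `q` merely
has to be closed. -/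
theorem HasHNF.seq {p q : RecTerm T m} (hp : HasHNF T m p) (hq : HasHNF T m q)
    (hqc : q.vars = ∅) : HasHNF T m (seq p q) := by
  obtain ⟨u, hu, hpu⟩ := hp
  refine HasHNF.of_derivable ?_ (.seq hpu (.refl q))
  clear hpu
  induction hu with
  | dead => exact HasHNF.dead.of_derivable (.of_acp (.A7 _))
  | empty => exact hq.of_derivable (.of_acp (.A9 _))
  | pre a t ht =>
    exact (IsHNF.pre a (Term.seq t q) (by simp [vars, ht, hqc])).hasHNF.of_derivable
      (.of_acp (.A5 _ _ _))
  | alt _ _ ih₁ ih₂ => exact (ih₁.alt ih₂).of_derivable (.of_acp (.A4 _ _ _))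

theorem HasHNF.encap {p : RecTerm T m} (hp : HasHNF T m p) (H : Set A) :
    HasHNF T m (encap H p) := by
  obtain ⟨u, hu, hpu⟩ := hp
  refine HasHNF.of_derivable ?_ (.encap hpu)
  clear hpu
  induction hu with
  | dead => exact HasHNF.dead.of_derivable (.of_acp (.D1 H none (by simp)))
  | empty => exact HasHNF.empty.of_derivable (.of_acp (.D0 H))
  | pre a t ht =>
    by_cases ha : a ∈ H
    · exact (hasHNF_seq_ofAct none (t := Term.encap H t) ht).of_derivable
        ((Derivable.of_acp (.D4 _ _ _)).trans (.seq (.of_acp (.D2 H a ha)) (.refl _)))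
    · exact (hasHNF_seq_ofAct (some a) (t := Term.encap H t) ht).of_derivable
        ((Derivable.of_acp (.D4 _ _ _)).trans
          (.seq (.of_acp (.D1 H (some a) (by rintro b ⟨⟩; exact ha))) (.refl _)))
  | alt _ _ ih₁ ih₂ => exact (ih₁.alt ih₂).of_derivable (.of_acp (.D3 _ _ _))

/-- The right operand always ends up behind the first action of the left one, so it need not have a
head normal form. -/
theorem HasHNF.leftm {p q : RecTerm T m} (hp : HasHNF T m p) (hqc : q.vars = ∅) :
    HasHNF T m (leftm p q) := by
  obtain ⟨u, hu, hpu⟩ := hp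
  refine HasHNF.of_derivable ?_ (.leftm hpu (.refl q))
  clear hpu
  induction hu with
  | dead =>
    -- No axiom treats `δ` as left operand directly: expand it to `δ · δ` by `A7` and apply `CM3`
    -- with `δ` as the prefix.
    exact HasHNF.dead.of_derivable ((Derivable.leftm (.symm (.of_acp (.A7 Term.dead)))
      (.refl q)).trans ((Derivable.of_acp (.CM3 none _ _)).trans (.of_acp (.A7 _))))
  | empty => exact HasHNF.dead.of_derivable (.of_acp (.CM2T _))
  | pre a t ht =>
    exact (IsHNF.pre a (Term.par t q) (by simp [vars, ht, hqc])).hasHNF.of_derivable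
      (.of_acp (.CM3 (some a) _ _))
  | alt _ _ ih₁ ih₂ => exact (ih₁.alt ih₂).of_derivable (.of_acp (.CM4 _ _ _))

theorem HasHNF.commm {p q : RecTerm T m} (hp : HasHNF T m p) (hq : HasHNF T m q) :
    HasHNF T m (commm p q) := by
  obtain ⟨u, hu, hpu⟩ := hp
  obtain ⟨v, hv, hqv⟩ := hq
  refine HasHNF.of_derivable ?_ (.commm hpu hqv)
  clear hpu hqv
  induction hu with
  | dead => exact HasHNF.dead.of_derivable (.of_acp (.CM11 _))
  | empty => exact HasHNF.dead.of_derivable (.of_acp (.CM5T _))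
  | pre a t ht =>
    induction hv with
    | dead => exact HasHNF.dead.of_derivable (.of_acp (.CM12 _))
    | empty => exact HasHNF.dead.of_derivable (.of_acp (.CM6T _))
    | pre b t' ht' =>
      exact (hasHNF_seq_ofAct (G.γ (some a) (some b)) (t := Term.par t t')
        (by simp [vars, ht, ht'])).of_derivable (.of_acp (.CM7 (some a) (some b) _ _))
    | alt _ _ ih₁ ih₂ => exact (ih₁.alt ih₂).of_derivable (.of_acp (.CM9 _ _ _))
  | alt _ _ ih₁ ih₂ => exact (ih₁.alt ih₂).of_derivable (.of_acp (.CM8 _ _ _))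

theorem HasHNF.par {p q : RecTerm T m} (hp : HasHNF T m p) (hq : HasHNF T m q)
    (hpc : p.vars = ∅) (hqc : q.vars = ∅) : HasHNF T m (par p q) :=
  HasHNF.of_derivable
    ((((hp.leftm hqc).alt (hq.leftm hpc)).alt (hp.commm hq)).alt
      ((hp.encap Set.univ).seq (hq.encap Set.univ) hqc))
    (.of_acp (.CM1T _ _))

theorem vars_update_eq_empty {n : ℕ} {x : Fin n → RecTerm T m} (hx : ∀ j, (x j).vars = ∅)
    (i : Fin n) {t : RecTerm T m} (ht : t.vars = ∅) (j : Fin n) :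
    (Function.update x i t j).vars = ∅ := by
  by_cases hj : j = i
  · subst hj; simpa using ht
  · simpa [hj] using hx j

/-! ### Head normal forms of strategic interleaving. -/

/-- If interleaving fewer processes in head normal form yields head normal forms, then so does
positional interleaving with the process in turn in head normal form. -/
theorem hasHNF_posm_of_isHNF {n : ℕ}
    (ih : ∀ k, n = k + 1 → ∀ (h : History) (s : S) (x : Fin (k + 1) → RecTerm T m),
      (∀ j, (x j).vars = ∅) → (∀ j, HasHNF T m (x j)) → HasHNF T m (si k h s x))
    (i : Fin (n + 1)) (h : History) (s : S) {u : RecTerm T m} (hu : IsHNF T m u)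
    (x : Fin (n + 1) → RecTerm T m) (hxu : x i = u) (hxc : ∀ j, (x j).vars = ∅)
    (hx : ∀ j, HasHNF T m (x j)) : HasHNF T m (posm n i h s x) := by
  induction hu generalizing x with
  | dead => exact HasHNF.dead.of_derivable (.of_si (.SI2 _ _ _ _ _ hxu))
  | empty =>
    cases n with
    | zero => exact HasHNF.empty.of_derivable (.of_si (.SI3T _ _ _ _ hxu))
    | succ k =>
      -- A terminated process is removed, and any remaining process may be next. This is why all
      -- components need a head normal form, not only the one in turn.
      exact (ih k rfl _ _ _ (fun j => hxc _) (fun j => hx _)).of_derivable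
        (.of_si (.SI4T _ _ _ _ _ hxu))
  | pre a t ht =>
    have hc := vars_update_eq_empty hxc i ht
    by_cases hreq : ∃ d, a = T.req d
    · obtain ⟨d, rfl⟩ := hreq
      -- The enlarged interleaving stands behind the creation act, so it only has to be closed; the
      -- growth in arity does not disturb the induction on the number of processes.
      refine (IsHNF.pre _ _ ?_).hasHNF.of_derivable (.of_si (.SI7 _ _ _ _ _ d t hxu))
      simp only [vars, Set.iUnion_eq_empty]
      refine Fin.lastCases ?_ (fun j => ?_)
      · rw [Fin.snoc_last]
        exact vars_inst_eq_empty (by simp [(T.created d).2])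
      · rw [Fin.snoc_castSucc]
        exact hc j
    by_cases hcr : ∃ d, a = T.crAct d
    · obtain ⟨d, rfl⟩ := hcr
      cases m with
      | blocked => exact HasHNF.dead.of_derivable (.of_si (.crActBlocked _ _ _ _ _ d t rfl hxu))
      | transparent =>
        exact (IsHNF.pre _ _ (by simpa [vars] using hc)).hasHNF.of_derivable
          (.of_si (.crActTransparent _ _ _ _ _ d t rfl hxu))
    have ha : ∀ d, a ≠ T.req d ∧ a ≠ T.crAct d := fun d =>
      ⟨fun e => hreq ⟨d, e⟩, fun e => hcr ⟨d, e⟩⟩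
    by_cases hC : a ∈ T.C
    · exact (IsHNF.pre _ _ (by simpa [vars] using hc)).hasHNF.of_derivable
        (.of_si (.SI5Tb _ _ _ _ _ a t hxu ha hC))
    · exact (IsHNF.pre _ _ (by simpa [vars] using hc)).hasHNF.of_derivable
        (.of_si (.SI5Ta _ _ _ _ _ a t hxu ha hC))
  | @alt p q hp hq ihp ihq =>
    have key : ∀ r : RecTerm T m, IsHNF T m r → ∀ j, HasHNF T m (Function.update x i r j) := by
      intro r hr j
      by_cases hj : j = i
      · subst hj; simpa using hr.hasHNF
      · simpa [hj] using hx j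
    exact ((ihp (Function.update x i p) (by simp) (vars_update_eq_empty hxc i hp.closed)
      (key p hp)).alt (ihq (Function.update x i q) (by simp)
        (vars_update_eq_empty hxc i hq.closed) (key q hq))).of_derivable
      (.of_si (.SI8 _ _ _ _ _ p q hxu))

theorem hasHNF_posm_of_lt {n : ℕ}
    (ih : ∀ k, n = k + 1 → ∀ (h : History) (s : S) (x : Fin (k + 1) → RecTerm T m),
      (∀ j, (x j).vars = ∅) → (∀ j, HasHNF T m (x j)) → HasHNF T m (si k h s x))
    (i : Fin (n + 1)) (h : History) (s : S) (x : Fin (n + 1) → RecTerm T m)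
    (hxc : ∀ j, (x j).vars = ∅) (hx : ∀ j, HasHNF T m (x j)) :
    HasHNF T m (posm n i h s x) := by
  obtain ⟨u, hu, hd⟩ := hx i
  -- Replace the process in turn by its head normal form, using congruence; the other components
  -- stay as they are.
  refine (hasHNF_posm_of_isHNF ih i h s hu (Function.update x i u) (by simp)
    (vars_update_eq_empty hxc i hu.closed) (fun j => ?_)).of_derivable (.posm fun j => ?_)
  all_goals by_cases hj : j = i
  · subst hj; simpa using hu.hasHNF
  · simpa [hj] using hx j
  · subst hj; simpa using hd
  · simpa [hj] using Derivable.refl (x j)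

/-- Induction on the number of processes. With a single process, the hypothesis about smaller
interleavings is vacuous. -/
theorem hasHNF_si {n : ℕ} (h : History) (s : S) (x : Fin (n + 1) → RecTerm T m)
    (hxc : ∀ j, (x j).vars = ∅) (hx : ∀ j, HasHNF T m (x j)) : HasHNF T m (si n h s x) := by
  induction n generalizing h s with
  | zero =>
    cases hs : T.sched 0 h s with
    | none => exact HasHNF.dead.of_derivable (.of_si (.SI0 _ _ _ _ hs))
    | some i =>
      exact (hasHNF_posm_of_lt (fun k hk => by omega) i h s x hxc hx).of_derivable
        (.of_si (.SI1 _ _ _ _ _ hs))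
  | succ n ih =>
    cases hs : T.sched (n + 1) h s with
    | none => exact HasHNF.dead.of_derivable (.of_si (.SI0 _ _ _ _ hs))
    | some i =>
      refine (hasHNF_posm_of_lt (fun k hk => ?_) i h s x hxc hx).of_derivable
        (.of_si (.SI1 _ _ _ _ _ hs))
      obtain rfl : n = k := by omega
      exact fun h s x => ih h s x

theorem hasHNF_posm {n : ℕ} (i : Fin (n + 1)) (h : History) (s : S)
    (x : Fin (n + 1) → RecTerm T m) (hxc : ∀ j, (x j).vars = ∅)
    (hx : ∀ j, HasHNF T m (x j)) : HasHNF T m (posm n i h s x) :=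
  hasHNF_posm_of_lt (fun _ _ h s x => hasHNF_si h s x) i h s x hxc hx

/-! ### Recursion constants and arbitrary closed terms. -/

/-- Closed instances of guarded terms have head normal forms. -/
theorem hasHNF_inst_of_guarded {σ : ℕ → RecTerm T m} {t : Term A S Empty} (ht : t.Guarded)
    (hσ : ∀ Y ∈ t.vars, (σ Y).vars = ∅) : HasHNF T m (t.inst σ) := by
  induction t with
  | dead => exact HasHNF.dead
  | empty => exact HasHNF.empty
  | act a => exact hasHNF_act a
  | const k => exact k.elim
  | var x => exact ht.elim
  | alt p q ihp ihq =>
    exact (ihp ht.1 fun Y hY => hσ Y (Or.inl hY)).alt (ihq ht.2 fun Y hY => hσ Y (Or.inr hY))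
  | seq p q ihp ihq =>
    have hqc := vars_inst_eq_empty fun Y hY => hσ Y (Or.inr hY)
    rcases ht.2 with ⟨a, rfl⟩ | hq
    -- Here guardedness pays off: the part behind the prefix may contain any variables, and only
    -- closedness of its instance is used.
    · exact (IsHNF.pre a _ hqc).hasHNF
    · exact (ihp ht.1 fun Y hY => hσ Y (Or.inl hY)).seq (ihq hq fun Y hY => hσ Y (Or.inr hY)) hqc
  | par p q ihp ihq =>
    exact (ihp ht.1 fun Y hY => hσ Y (Or.inl hY)).par (ihq ht.2 fun Y hY => hσ Y (Or.inr hY))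
      (vars_inst_eq_empty fun Y hY => hσ Y (Or.inl hY))
      (vars_inst_eq_empty fun Y hY => hσ Y (Or.inr hY))
  | leftm p q ihp _ =>
    exact (ihp ht.1 fun Y hY => hσ Y (Or.inl hY)).leftm
      (vars_inst_eq_empty fun Y hY => hσ Y (Or.inr hY))
  | commm p q ihp ihq =>
    exact (ihp ht.1 fun Y hY => hσ Y (Or.inl hY)).commm (ihq ht.2 fun Y hY => hσ Y (Or.inr hY))
  | encap H p ih => exact (ih ht hσ).encap H
  | si n h s x ih =>
    exact hasHNF_si h s _
      (fun j => vars_inst_eq_empty fun Y hY => hσ Y (Set.mem_iUnion_of_mem j hY))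
      (fun j => ih j (ht j) fun Y hY => hσ Y (Set.mem_iUnion_of_mem j hY))
  | posm n i h s x ih =>
    exact hasHNF_posm i h s _
      (fun j => vars_inst_eq_empty fun Y hY => hσ Y (Set.mem_iUnion_of_mem j hY))
      (fun j => ih j (ht j) fun Y hY => hσ Y (Set.mem_iUnion_of_mem j hY))

theorem Spec.IsGuarded.vars_eq_lhs {L : Term A S Empty → Prop}
    {Ax : Term A S Empty → Term A S Empty → Prop} {E : Spec A S} (hE : E.IsGuarded L Ax) :
    E.vars = E.lhs := by
  refine Set.union_eq_self_of_subset_right ?_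
  rintro X ⟨Y, t, hY, hX⟩
  exact (hE Y t hY).2.1 hX

theorem inst_recSubst_var {E : Spec A S} (hE : E.IsGuardedSIACP T m) {X : ℕ} (hX : X ∈ E.vars) :
    (var X : Term A S Empty).inst (recSubst T m E hE) = recTerm T m E hE X hX :=
  dif_pos hX

/-- The constants for solutions of guarded recursive specifications have head normal forms. -/
theorem hasHNF_recTerm {E : Spec A S} (hE : E.IsGuardedSIACP T m) {X : ℕ} (hX : X ∈ E.vars) :
    HasHNF T m (recTerm T m E hE X hX) := by
  have hX' := hX
  rw [hE.vars_eq_lhs] at hX'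
  obtain ⟨t, ht⟩ := hX'
  obtain ⟨-, -, t', -, hv', hg, hr⟩ := hE X t ht
  -- Unfold once by RDP, then rewrite to the guarded term; nothing about head normal forms of the
  -- other constants is assumed, so there is no circularity.
  refine (hasHNF_inst_of_guarded (σ := recSubst T m E hE) hg fun Y hY => ?_).of_derivable
    ((Derivable.rdp E hE X hX t ht).trans (hr.derivable_inst ?_))
  · have hY' : Y ∈ E.vars := Or.inl (hv' hY)
    rw [recSubst, dif_pos hY']
    rfl
  · rintro _ r ⟨Y, -, rfl, hY⟩
    rw [inst_recSubst_var hE (Or.inl ⟨r, hY⟩)]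
    exact .rdp E hE Y _ r hY

/-- Every closed term has a head normal form. -/
theorem hasHNF_of_closed {t : RecTerm T m} (ht : t.vars = ∅) : HasHNF T m t := by
  induction t with
  | dead => exact HasHNF.dead
  | empty => exact HasHNF.empty
  | act a => exact hasHNF_act a
  | const k => exact hasHNF_recTerm k.guarded k.mem
  | var x => simp [vars] at ht
  | alt p q ihp ihq =>
    rw [vars, Set.union_empty_iff] at ht
    exact (ihp ht.1).alt (ihq ht.2)
  | seq p q ihp ihq =>
    rw [vars, Set.union_empty_iff] at ht
    exact (ihp ht.1).seq (ihq ht.2) ht.2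
  | par p q ihp ihq =>
    rw [vars, Set.union_empty_iff] at ht
    exact (ihp ht.1).par (ihq ht.2) ht.1 ht.2
  | leftm p q ihp _ =>
    rw [vars, Set.union_empty_iff] at ht
    exact (ihp ht.1).leftm ht.2
  | commm p q ihp ihq =>
    rw [vars, Set.union_empty_iff] at ht
    exact (ihp ht.1).commm (ihq ht.2)
  | encap H p ih => exact (ih ht).encap H
  | si n h s x ih =>
    rw [vars, Set.iUnion_eq_empty] at ht
    exact hasHNF_si h s x ht fun j => ih j (ht j)
  | posm n i h s x ih =>
    rw [vars, Set.iUnion_eq_empty] at ht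
    exact hasHNF_posm i h s x ht fun j => ih j (ht j)

/-! ### The ACPε specification of a closed term. -/

/-- A head normal form is an instance, by closed terms, of a guarded ACPε term. -/
theorem IsHNF.exists_inst {u : RecTerm T m} (hu : IsHNF T m u) :
    ∃ (w : Term A S Empty) (σ : ℕ → {t : RecTerm T m // t.vars = ∅}),
      w.IsACP ∧ w.Guarded ∧ w.inst (fun k => (σ k).1) = u := by
  induction hu with
  -- Substitutions take values in the closed terms at all variables, so that taking successors can
  -- be iterated; `δ` is a filler for variables that do not occur.
  | dead => exact ⟨Term.dead, fun _ => ⟨Term.dead, rfl⟩, trivial, trivial, rfl⟩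
  | empty => exact ⟨Term.empty, fun _ => ⟨Term.dead, rfl⟩, trivial, trivial, rfl⟩
  | pre a t ht =>
    exact ⟨Term.seq (act a) (var 0), fun _ => ⟨t, ht⟩, ⟨trivial, trivial⟩,
      ⟨trivial, Or.inl ⟨a, rfl⟩⟩, rfl⟩
  | alt _ _ ih₁ ih₂ =>
    obtain ⟨w₁, σ₁, hw₁, hg₁, rfl⟩ := ih₁
    obtain ⟨w₂, σ₂, hw₂, hg₂, rfl⟩ := ih₂
    -- The variables of the two summands are renamed apart, so that one substitution serves both.
    let e := Equiv.natSumNatEquivNat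
    refine ⟨Term.alt (w₁.inst fun k => var (e (.inl k))) (w₂.inst fun k => var (e (.inr k))),
      fun k => Sum.elim σ₁ σ₂ (e.symm k), ⟨isACP_inst_var _ hw₁, isACP_inst_var _ hw₂⟩,
      ⟨guarded_inst_var _ hg₁, guarded_inst_var _ hg₂⟩, ?_⟩
    simp only [Term.inst, inst_inst_var, Equiv.symm_apply_apply, Sum.elim_inl, Sum.elim_inr]

theorem exists_guarded_inst (t : {t : RecTerm T m // t.vars = ∅}) :
    ∃ (w : Term A S Empty) (σ : ℕ → {t : RecTerm T m // t.vars = ∅}),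
      w.IsACP ∧ w.Guarded ∧ Derivable T m t.1 (w.inst fun k => (σ k).1) := by
  obtain ⟨u, hu, hd⟩ := hasHNF_of_closed t.2
  obtain ⟨w, σ, hw, hg, rfl⟩ := hu.exists_inst
  exact ⟨w, σ, hw, hg, hd⟩

/-- The closed term that is reached from `t` by going, for the numbers in a list, last one first,
to the successor with that number. -/
def reach {α : Type*} (succ : α → ℕ → α) (t : α) : List ℕ → α
  | [] => t
  | k :: l => succ (reach succ t l) k

/-- Every closed term is derivably the solution, for any given variable, of a guarded recursive
specification over ACPε. -/
theorem exists_spec_of_closed {t : RecTerm T m} (ht : t.vars = ∅) (X : ℕ) :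
    ∃ (E : Spec A S) (hE : E.IsGuardedACP G) (hX : X ∈ E.vars),
      Derivable T m t (recTerm T m E (hE.toSIACP T m) X hX) := by
  -- Fix for each closed term one guarded ACPε term `w` and its numbered successors `succ`.
  choose w succ hw hg hd using exists_guarded_inst (T := T) (m := m)
  let e₀ : List ℕ ≃ ℕ := Denumerable.eqv (List ℕ)
  -- The swap makes the prescribed variable `X` the code of the root `[]`.
  let e : List ℕ ≃ ℕ := e₀.trans (Equiv.swap (e₀ []) X)
  have he : e.symm X = [] := by simp [e]
  let state : List ℕ → {t : RecTerm T m // t.vars = ∅} := reach succ ⟨t, ht⟩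
  -- The variable numbered `k` in the term at a node becomes the variable coding its `k`th child.
  let rhs : ℕ → Term A S Empty := fun Y =>
    (w (state (e.symm Y))).inst fun k => var (e (k :: e.symm Y))
  let E : Spec A S := fun Y => some (rhs Y)
  have hlhs : E.lhs = Set.univ := Set.eq_univ_of_forall fun Y => ⟨rhs Y, rfl⟩
  have hE : E.IsGuardedACP G := by
    rintro Y _ ⟨⟩
    have h : (rhs Y).IsACP := isACP_inst_var _ (hw _)
    have hv : (rhs Y).vars ⊆ E.lhs := hlhs ▸ Set.subset_univ _
    -- The right-hand sides are already guarded, so zero rewriting steps suffice.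
    exact ⟨h, hv, rhs Y, h, hv, guarded_inst_var _ (hg _), .refl _⟩
  have hX : X ∈ E.vars := Or.inl ⟨rhs X, rfl⟩
  refine ⟨E, hE, hX, ?_⟩
  -- The closed terms at the nodes form a solution: instantiating `rhs Y` with them gives back the
  -- chosen decomposition of the term at the node coded by `Y`.
  have := Derivable.rsp E (hE.toSIACP T m) X hX (fun Y => (state (e.symm Y)).1) (by
    rintro Y _ ⟨⟩
    simp only [rhs, inst_inst_var, Equiv.symm_apply_apply]
    exact hd (state (e.symm Y)))
  simpa only [he, state, reach] using this

end HeadNormalForms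

end StrategicInterleaving

theorem theorem1 {A : Type u} {S : Type v} {D : Type z} [Countable D]
    (G : StrategicInterleaving.Communication A) (T : StrategicInterleaving.Strategy A S D G)
    (m : StrategicInterleaving.CrActMode)
    (E : StrategicInterleaving.Spec A S) (hE : E.IsGuardedSIACP T m) (X : ℕ) (hX : X ∈ E.vars) :
    ∃ (E' : StrategicInterleaving.Spec A S) (hE' : E'.IsGuardedACP G) (hX' : X ∈ E'.vars),
      StrategicInterleaving.Derivable T m
        (StrategicInterleaving.recTerm T m E hE X hX)
        (StrategicInterleaving.recTerm T m E' (hE'.toSIACP T m) X hX') := by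
  exact StrategicInterleaving.exists_spec_of_closed rfl X
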